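/- Let $\mathbb{K}\in\{\mathbb{R},\mathbb{C}\}$ and let $A\in\mathbb{K}^{m\times n}$ be a nonzero matrix of rank $k$ with stable rank $r=\|A\|_F^2/\|A\|_2^2$ and generalized condition number $\kappa(A)=\sigma_1(A)/\sigma_k(A)$ (the ratio of the largest to the smallest nonzero singular value). Let $\delta\in(0,1)$, and let $d_1,d_2$ be natural numbers with \[ d_1,\,d_2\;\ge\; 8\,r\,\kappa(A)^2\Big(\log(2k)+\frac1\delta\Big). \] Draw a list $J$ of $d_1$ column indices independently with replacement from $\{1,\dots,n\}$ with probabilities $p_j^{\mathrm{col}}=\|A(:,j)\|_2^2/\|A\|_F^2$ and, independently of $J$, a list $I$ of $d_2$ row indices independently with replacement from $\{1,\dots,m\}$ with probabilities $q_i^{\mathrm{row}}=\|A(i,:)\|_2^2/\|A\|_F^2$. Put $C=A(:,J)$, $R=A(I,:)$, $U=A(I,J)$ (repeated indices are kept), and let $U^\dagger$ denote the Moore–Penrose pseudoinverse of $U$. Then \[ \Pr\big(A=CU^\dagger R\big)\;\ge\;\big(1-2e^{-1/\delta}\big)^2 . \] -/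

import Mathlib

open scoped Matrix

noncomputable section

/-- `X` satisfies the four Penrose equations for `A`. -/
structure IsMoorePenroseInverse {𝕜 : Type*} [RCLike 𝕜] {m n : ℕ}
    (A : Matrix (Fin m) (Fin n) 𝕜) (X : Matrix (Fin n) (Fin m) 𝕜) : Prop where
  mul_mul_self : A * X * A = A
  self_mul_mul : X * A * X = X
  left_hermitian : (A * X)ᴴ = A * X
  right_hermitian : (X * A)ᴴ = X * A

open scoped ComplexOrder in
theorem exists_isMoorePenroseInverse {𝕜 : Type*} [RCLike 𝕜] {m n : ℕ}
    (A : Matrix (Fin m) (Fin n) 𝕜) : ∃ X, IsMoorePenroseInverse A X := by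
  have hH : (Aᴴ * A).IsHermitian := Matrix.isHermitian_conjTranspose_mul_self A
  obtain ⟨P, hP, h1, h2, h3⟩ : ∃ P : Matrix (Fin n) (Fin n) 𝕜, Pᴴ = P ∧
      (Aᴴ * A) * P * (Aᴴ * A) = Aᴴ * A ∧ P * (Aᴴ * A) * P = P ∧
      (Aᴴ * A) * P = P * (Aᴴ * A) := by
    have hs := hH.spectral_theorem
    rw [Unitary.conjStarAlgAut_apply] at hs
    generalize hU : hH.eigenvectorUnitary = U at hs
    have hUU : (star (U : Matrix (Fin n) (Fin n) 𝕜)) * (U : Matrix (Fin n) (Fin n) 𝕜) = 1 :=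
      Unitary.coe_star_mul_self U
    generalize hD : Matrix.diagonal (RCLike.ofReal ∘ hH.eigenvalues : Fin n → 𝕜) = D at hs
    set E : Matrix (Fin n) (Fin n) 𝕜 :=
      Matrix.diagonal (fun i => ((hH.eigenvalues i : 𝕜))⁻¹) with hE
    have hDED : D * E * D = D := by
      rw [← hD, hE, Matrix.diagonal_mul_diagonal, Matrix.diagonal_mul_diagonal]
      congr 1
      funext i
      by_cases h : (hH.eigenvalues i : 𝕜) = 0 <;> simp_all
    have hEDE : E * D * E = E := by
      rw [← hD, hE, Matrix.diagonal_mul_diagonal, Matrix.diagonal_mul_diagonal]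
      congr 1
      funext i
      by_cases h : (hH.eigenvalues i : 𝕜) = 0 <;> simp_all
    have hDE : D * E = E * D := by
      rw [← hD, hE, Matrix.diagonal_mul_diagonal, Matrix.diagonal_mul_diagonal]
      congr 1
      funext i
      exact mul_comm _ _
    have hEh : star E = E := by
      rw [hE, Matrix.star_eq_conjTranspose, Matrix.diagonal_conjTranspose]
      congr 1
      funext i
      simp
    generalize (U : Matrix (Fin n) (Fin n) 𝕜) = V at hs hUU
    have key : ∀ X Y : Matrix (Fin n) (Fin n) 𝕜,
        (V * X * star V) * (V * Y * star V) = V * (X * Y) * star V := by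
      intro X Y
      calc (V * X * star V) * (V * Y * star V) = V * X * (star V * V) * Y * star V := by
            simp only [Matrix.mul_assoc]
        _ = V * (X * Y) * star V := by rw [hUU]; simp only [Matrix.mul_assoc, Matrix.mul_one]
    refine ⟨V * E * star V, ?_, ?_, ?_, ?_⟩
    · rw [← Matrix.star_eq_conjTranspose]
      simp only [star_mul, star_star, hEh, mul_assoc]
    · rw [hs, key, key, hDED]
    · rw [hs, key, key, hEDE]
    · rw [hs, key, key, hDE]
  have hA : A * P * (Aᴴ * A) = A := by
    have h0 : A * (P * (Aᴴ * A) - 1) = 0 := by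
      rw [← Matrix.conjTranspose_mul_self_eq_zero, Matrix.conjTranspose_mul]
      have : Aᴴ * (A * (P * (Aᴴ * A) - 1)) = 0 := by
        rw [← Matrix.mul_assoc, Matrix.mul_sub, ← Matrix.mul_assoc, h1, Matrix.mul_one, sub_self]
      rw [Matrix.mul_assoc, this, Matrix.mul_zero]
    rw [Matrix.mul_sub, Matrix.mul_one, sub_eq_zero] at h0
    rw [Matrix.mul_assoc]
    exact h0
  refine ⟨P * Aᴴ, ?_, ?_, ?_, ?_⟩
  · simpa only [Matrix.mul_assoc] using hA
  · have := congrArg (· * Aᴴ) h2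
    simpa only [Matrix.mul_assoc] using this
  · simp only [Matrix.conjTranspose_mul, Matrix.conjTranspose_conjTranspose, hP, Matrix.mul_assoc]
  · rw [Matrix.mul_assoc, ← h3]
    simp only [Matrix.conjTranspose_mul, Matrix.conjTranspose_conjTranspose, hP]
    simpa only [Matrix.mul_assoc] using h3.symm

theorem IsMoorePenroseInverse.unique {𝕜 : Type*} [RCLike 𝕜] {m n : ℕ}
    {A : Matrix (Fin m) (Fin n) 𝕜} {X Y : Matrix (Fin n) (Fin m) 𝕜}
    (hX : IsMoorePenroseInverse A X) (hY : IsMoorePenroseInverse A Y) : X = Y := by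
  have e1 : A * X = A * Y := by
    have h : A * X * (A * Y) = A * Y := by rw [← Matrix.mul_assoc, hX.mul_mul_self]
    have h' := congrArg Matrix.conjTranspose h
    rw [Matrix.conjTranspose_mul, hX.left_hermitian, hY.left_hermitian, ← Matrix.mul_assoc,
      hY.mul_mul_self] at h'
    exact h'
  have e2 : X * A = Y * A := by
    have h : X * A * (Y * A) = X * A := by
      rw [Matrix.mul_assoc, ← Matrix.mul_assoc A, hY.mul_mul_self]
    have h' := congrArg Matrix.conjTranspose h
    rw [Matrix.conjTranspose_mul, hX.right_hermitian, hY.right_hermitian, Matrix.mul_assoc,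
      ← Matrix.mul_assoc A, hX.mul_mul_self] at h'
    exact h'.symm
  rw [← hX.self_mul_mul, e2, Matrix.mul_assoc, e1, ← Matrix.mul_assoc, hY.self_mul_mul]

/-- The Moore–Penrose pseudoinverse: the unique solution of the four Penrose equations. -/
def moorePenroseInverse {𝕜 : Type*} [RCLike 𝕜] {m n : ℕ}
    (A : Matrix (Fin m) (Fin n) 𝕜) : Matrix (Fin n) (Fin m) 𝕜 :=
  (exists_isMoorePenroseInverse A).choose

theorem moorePenroseInverse_spec {𝕜 : Type*} [RCLike 𝕜] {m n : ℕ}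
    (A : Matrix (Fin m) (Fin n) 𝕜) : IsMoorePenroseInverse A (moorePenroseInverse A) :=
  (exists_isMoorePenroseInverse A).choose_spec

/-- `A` as a linear map between Euclidean (ℓ²) spaces. -/
abbrev euclideanMap {𝕜 : Type*} [RCLike 𝕜] {m n : ℕ} (A : Matrix (Fin m) (Fin n) 𝕜) :
    EuclideanSpace 𝕜 (Fin n) →ₗ[𝕜] EuclideanSpace 𝕜 (Fin m) :=
  Matrix.toEuclideanLin A

/-- The squared Frobenius norm `‖A‖_F²`. -/
def frobeniusSq {𝕜 : Type*} [RCLike 𝕜] {m n : ℕ} (A : Matrix (Fin m) (Fin n) 𝕜) : ℝ :=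
  ∑ i, ∑ j, ‖A i j‖ ^ 2

/-- The spectral norm `‖A‖₂`: the operator norm between Euclidean spaces. -/
def spectralNorm₂ {𝕜 : Type*} [RCLike 𝕜] {m n : ℕ} (A : Matrix (Fin m) (Fin n) 𝕜) : ℝ :=
  ‖(euclideanMap A).toContinuousLinearMap‖

/-- The stable rank `‖A‖_F² / ‖A‖₂²`. -/
def stableRank {𝕜 : Type*} [RCLike 𝕜] {m n : ℕ} (A : Matrix (Fin m) (Fin n) 𝕜) : ℝ :=
  frobeniusSq A / spectralNorm₂ A ^ 2

/-- The generalized spectral condition number: the largest singular value divided by the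
smallest nonzero one. `LinearMap.singularValues` is decreasing and indexed from `0`, so these are
the values at `0` and at `rank A - 1`. Only meaningful for `A ≠ 0`. -/
def condNumber {𝕜 : Type*} [RCLike 𝕜] {m n : ℕ} (A : Matrix (Fin m) (Fin n) 𝕜) : ℝ :=
  (euclideanMap A).singularValues 0 / (euclideanMap A).singularValues (A.rank - 1)

theorem frobeniusSq_pos {𝕜 : Type*} [RCLike 𝕜] {m n : ℕ} {A : Matrix (Fin m) (Fin n) 𝕜}
    (hA : A ≠ 0) : 0 < frobeniusSq A := by
  obtain ⟨i, j, hij⟩ : ∃ i j, A i j ≠ 0 := by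
    by_contra! h
    exact hA (Matrix.ext h)
  have h1 : 0 < ‖A i j‖ ^ 2 := by positivity
  refine h1.trans_le ?_
  refine (Finset.single_le_sum (f := fun j => ‖A i j‖ ^ 2) (fun _ _ => by positivity)
    (Finset.mem_univ j)).trans ?_
  exact Finset.single_le_sum (f := fun i => ∑ j, ‖A i j‖ ^ 2) (fun _ _ => by positivity)
    (Finset.mem_univ i)

/-- The column-length distribution `p_j = ‖A(:,j)‖₂² / ‖A‖_F²` of a nonzero matrix. -/
def colLengthPMF {𝕜 : Type*} [RCLike 𝕜] {m n : ℕ} (A : Matrix (Fin m) (Fin n) 𝕜)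
    (hA : A ≠ 0) : PMF (Fin n) :=
  PMF.ofFintype (fun j => ENNReal.ofReal ((∑ i, ‖A i j‖ ^ 2) / frobeniusSq A)) (by
    rw [← ENNReal.ofReal_sum_of_nonneg
        (fun j _ => div_nonneg (by positivity) (frobeniusSq_pos hA).le),
      ← Finset.sum_div, Finset.sum_comm]
    change ENNReal.ofReal (frobeniusSq A / frobeniusSq A) = 1
    rw [div_self (frobeniusSq_pos hA).ne', ENNReal.ofReal_one])

/-- The row-length distribution `q_i = ‖A(i,:)‖₂² / ‖A‖_F²` of a nonzero matrix. -/
def rowLengthPMF {𝕜 : Type*} [RCLike 𝕜] {m n : ℕ} (A : Matrix (Fin m) (Fin n) 𝕜)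
    (hA : A ≠ 0) : PMF (Fin m) :=
  PMF.ofFintype (fun i => ENNReal.ofReal ((∑ j, ‖A i j‖ ^ 2) / frobeniusSq A)) (by
    rw [← ENNReal.ofReal_sum_of_nonneg
        (fun j _ => div_nonneg (by positivity) (frobeniusSq_pos hA).le),
      ← Finset.sum_div]
    change ENNReal.ofReal (frobeniusSq A / frobeniusSq A) = 1
    rw [div_self (frobeniusSq_pos hA).ne', ENNReal.ofReal_one])

/-- The joint law of `d₁` column indices drawn independently with replacement from the
column-length distribution and, independently of them, `d₂` row indices drawn independently with
replacement from the row-length distribution. A sample is a pair `(J, I)` of index lists. -/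
def lengthSampling {𝕜 : Type*} [RCLike 𝕜] {m n : ℕ} (A : Matrix (Fin m) (Fin n) 𝕜)
    (hA : A ≠ 0) (d₁ d₂ : ℕ) :
    MeasureTheory.Measure ((Fin d₁ → Fin n) × (Fin d₂ → Fin m)) :=
  (MeasureTheory.Measure.pi fun _ : Fin d₁ => (colLengthPMF A hA).toMeasure).prod
    (MeasureTheory.Measure.pi fun _ : Fin d₂ => (rowLengthPMF A hA).toMeasure)

/-- The column submatrix `A(:,J)`, one column for each entry of the list `J`
(repetitions are kept). -/
def colSubmatrix {𝕜 : Type*} [RCLike 𝕜] {m n d₁ : ℕ} (A : Matrix (Fin m) (Fin n) 𝕜)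
    (J : Fin d₁ → Fin n) : Matrix (Fin m) (Fin d₁) 𝕜 :=
  A.submatrix id J

/-- The row submatrix `A(I,:)`. -/
def rowSubmatrix {𝕜 : Type*} [RCLike 𝕜] {m n d₂ : ℕ} (A : Matrix (Fin m) (Fin n) 𝕜)
    (I : Fin d₂ → Fin m) : Matrix (Fin d₂) (Fin n) 𝕜 :=
  A.submatrix I id

end

/-! If `C` and `R` both have rank `k`, then `A = C X = Zᵀ R`, hence `C = Zᵀ U`, `R = U X` and `A =
Zᵀ U X = Zᵀ U U† U X = C U† R`. It remains to bound the probability that a length-squared sample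
loses rank. Let `s = σ_k² / ‖A‖_F²`. If the columns drawn so far span `V` inside the column space
`W`, the columns outside `V` have total probability at least `s (dim W - dim V)`, and drawing any of
them lowers the missing dimension by at least one. The expected missing dimension after `d` draws is
thus at most `k (1 - s)^d`, and Markov's inequality bounds the failure probability by the same
number. Since `1 / s ≤ r κ²`, this is at most `2 exp (-1/δ)`. Rows are the columns of `Aᴴ`, and
independence multiplies the two probabilities. No matrix concentration inequality is needed. -/

/-! ### Missing dimension of the span of independent draws. -/

open Module Submodule in
/-- If every `u` in the span of the `a j` satisfies the frame bound `s ‖u‖² ≤ ∑ ‖⟪u, a j⟫‖²`, then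
the vectors outside a subspace `V` of the span carry squared length at least `s` per missing
dimension. -/
theorem mul_codim_le_sum_norm_sq_of_notMem {𝕜 E ι : Type*} [RCLike 𝕜] [NormedAddCommGroup E]
    [InnerProductSpace 𝕜 E] [FiniteDimensional 𝕜 E] [Fintype ι] (a : ι → E)
    (W V : Submodule 𝕜 E) (hVW : V ≤ W) {s : ℝ}
    (hs : ∀ u ∈ W, s * ‖u‖ ^ 2 ≤ ∑ j, ‖inner 𝕜 u (a j)‖ ^ 2) [DecidablePred fun j => a j ∉ V] :
    ((finrank 𝕜 W : ℝ) - finrank 𝕜 V) * s ≤ ∑ j with a j ∉ V, ‖a j‖ ^ 2 := by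
  -- The frame bound is summed over an orthonormal basis of the complement of `V` in `W`. Each `a j
  -- ∈ V` is orthogonal to it; the others are controlled by Bessel's inequality.
  set b := stdOrthonormalBasis 𝕜 (Vᗮ ⊓ W : Submodule 𝕜 E)
  have hb : Orthonormal 𝕜 (fun i => (b i : E)) :=
    b.orthonormal.comp_linearIsometry (Vᗮ ⊓ W : Submodule 𝕜 E).subtypeₗᵢ
  have hdim : ((finrank 𝕜 W : ℝ) - finrank 𝕜 V) = finrank 𝕜 (Vᗮ ⊓ W : Submodule 𝕜 E) := by
    rw [← finrank_add_inf_finrank_orthogonal hVW]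
    push_cast
    ring
  calc ((finrank 𝕜 W : ℝ) - finrank 𝕜 V) * s
      = ∑ i, s * ‖(b i : E)‖ ^ 2 := by simp [hb.1, hdim]
    _ ≤ ∑ i, ∑ j, ‖inner 𝕜 (b i : E) (a j)‖ ^ 2 :=
        Finset.sum_le_sum fun i _ => hs _ (b i).2.2
    _ = ∑ j, ∑ i, ‖inner 𝕜 (b i : E) (a j)‖ ^ 2 := Finset.sum_comm
    _ ≤ ∑ j, if a j ∉ V then ‖a j‖ ^ 2 else 0 := by
        refine Finset.sum_le_sum fun j _ => ?_
        split_ifs with h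
        · refine (Finset.sum_eq_zero fun i _ => ?_).le
          rw [inner_left_of_mem_orthogonal h (b i).2.1]
          simp
        · exact hb.sum_inner_products_le (a j)
    _ = ∑ j with a j ∉ V, ‖a j‖ ^ 2 := by rw [Finset.sum_filter]

open Module Submodule in
/-- One draw reduces the expected missing dimension by the factor `1 - s`. -/
theorem sum_mul_codim_sup_span_singleton_le {𝕜 E ι : Type*} [RCLike 𝕜] [NormedAddCommGroup E]
    [InnerProductSpace 𝕜 E] [FiniteDimensional 𝕜 E] [Fintype ι] (a : ι → E) (p : ι → ℝ)
    (hp0 : ∀ j, 0 ≤ p j) (hp1 : ∑ j, p j = 1) (W V : Submodule 𝕜 E) {s : ℝ}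
    (hs : ∀ [DecidablePred fun j => a j ∉ V],
      ((finrank 𝕜 W : ℝ) - finrank 𝕜 V) * s ≤ ∑ j with a j ∉ V, p j) :
    ∑ j, p j * ((finrank 𝕜 W : ℝ) - finrank 𝕜 (span 𝕜 {a j} ⊔ V : Submodule 𝕜 E)) ≤
      ((finrank 𝕜 W : ℝ) - finrank 𝕜 V) * (1 - s) := by
  classical
  have key : ∀ j, p j * ((finrank 𝕜 W : ℝ) - finrank 𝕜 (span 𝕜 {a j} ⊔ V : Submodule 𝕜 E)) ≤
      p j * ((finrank 𝕜 W : ℝ) - finrank 𝕜 V) - if a j ∉ V then p j else 0 := by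
    intro j
    split_ifs with h
    · have : span 𝕜 {a j} ⊔ V = V := sup_eq_right.2 ((span_singleton_le_iff_mem _ _).2 h)
      rw [this, sub_zero]
    · have hlt : V < span 𝕜 {a j} ⊔ V := by
        refine lt_of_le_of_ne le_sup_right fun he => h ?_
        rw [he]
        exact le_sup_left (a := span 𝕜 {a j}) (mem_span_singleton_self _)
      have := finrank_lt_finrank_of_lt hlt
      have : (finrank 𝕜 V : ℝ) + 1 ≤ finrank 𝕜 (span 𝕜 {a j} ⊔ V : Submodule 𝕜 E) := by
        exact_mod_cast this
      nlinarith [hp0 j]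
  refine (Finset.sum_le_sum fun j _ => key j).trans ?_
  rw [Finset.sum_sub_distrib, ← Finset.sum_mul, hp1, ← Finset.sum_filter]
  linarith [hs]

open Module Submodule in
/-- The expected dimension missing from the span of `d` independent draws decays geometrically. -/
theorem sum_prod_mul_codim_span_le {𝕜 E ι : Type*} [RCLike 𝕜] [NormedAddCommGroup E]
    [InnerProductSpace 𝕜 E] [FiniteDimensional 𝕜 E] [Fintype ι] (a : ι → E) (p : ι → ℝ)
    (hp0 : ∀ j, 0 ≤ p j) (hp1 : ∑ j, p j = 1) (W : Submodule 𝕜 E) (haW : ∀ j, a j ∈ W) {s : ℝ}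
    (hs1 : s ≤ 1)
    (hs : ∀ V ≤ W, ∀ [DecidablePred fun j => a j ∉ V],
      ((finrank 𝕜 W : ℝ) - finrank 𝕜 V) * s ≤ ∑ j with a j ∉ V, p j) (d : ℕ) :
    ∑ J : Fin d → ι, (∏ i, p (J i)) *
      ((finrank 𝕜 W : ℝ) - finrank 𝕜 (span 𝕜 (Set.range fun i => a (J i)))) ≤
      finrank 𝕜 W * (1 - s) ^ d := by
  induction d with
  | zero => simp
  | succ d ih =>
    -- The extra draw is put at the head of the list and averaged with the tail `J` fixed; the span
    -- does not depend on the order.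
    rw [← (Fin.consEquiv fun _ : Fin (d + 1) => ι).sum_comp, Fintype.sum_prod_type_right]
    calc _ ≤ ∑ J : Fin d → ι, (∏ i, p (J i)) *
          (((finrank 𝕜 W : ℝ) - finrank 𝕜 (span 𝕜 (Set.range fun i => a (J i)))) * (1 - s)) := by
          refine Finset.sum_le_sum fun J _ => ?_
          have hJ : span 𝕜 (Set.range fun i => a (J i)) ≤ W :=
            span_le.2 (Set.range_subset_iff.2 fun i => haW _)
          refine le_trans (le_of_eq ?_) (mul_le_mul_of_nonneg_left
            (sum_mul_codim_sup_span_singleton_le a p hp0 hp1 W _ (hs _ hJ))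
            (Finset.prod_nonneg fun i _ => hp0 (J i)))
          rw [Finset.mul_sum]
          refine Finset.sum_congr rfl fun j _ => ?_
          have hr : (Set.range fun i : Fin (d + 1) =>
              a ((Fin.consEquiv fun _ : Fin (d + 1) => ι) (j, J) i)) =
              insert (a j) (Set.range fun i => a (J i)) := by
            ext x
            simp [Fin.exists_fin_succ, Fin.consEquiv, eq_comm]
          rw [hr, span_insert, Fin.prod_univ_succ]
          simp only [Fin.consEquiv, Equiv.coe_fn_mk, Fin.cons_zero, Fin.cons_succ]
          ring
      _ ≤ _ := by
          simp_rw [← mul_assoc]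
          rw [← Finset.sum_mul, pow_succ, ← mul_assoc]
          exact mul_le_mul_of_nonneg_right ih (by linarith)

open Module Submodule MeasureTheory in
/-- Markov's inequality for the missing dimension: `d` independent draws from the law `P` span `W`
except with probability at most `dim W * (1 - s) ^ d`. -/
theorem one_sub_le_pi_finrank_span_eq {𝕜 E : Type*} [RCLike 𝕜] [NormedAddCommGroup E]
    [InnerProductSpace 𝕜 E] [FiniteDimensional 𝕜 E] {n : ℕ} (a : Fin n → E) (P : PMF (Fin n))
    (W : Submodule 𝕜 E) (haW : ∀ j, a j ∈ W) {s : ℝ} (hs1 : s ≤ 1)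
    (hs : ∀ V ≤ W, ∀ [DecidablePred fun j => a j ∉ V],
      ((finrank 𝕜 W : ℝ) - finrank 𝕜 V) * s ≤ ∑ j with a j ∉ V, (P j).toReal) (d : ℕ) :
    ENNReal.ofReal (1 - finrank 𝕜 W * (1 - s) ^ d) ≤
      Measure.pi (fun _ : Fin d => P.toMeasure)
        {J | finrank 𝕜 (span 𝕜 (Set.range fun i => a (J i))) = finrank 𝕜 W} := by
  classical
  set μ := Measure.pi (fun _ : Fin d => P.toMeasure)
  set S := {J : Fin d → Fin n |
    finrank 𝕜 (span 𝕜 (Set.range fun i => a (J i))) = finrank 𝕜 W} with hS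
  have hp1 : ∑ j, (P j).toReal = 1 := by
    rw [← ENNReal.toReal_sum fun j _ => P.apply_ne_top j, ← tsum_fintype (L := .unconditional _),
      P.tsum_coe, ENNReal.toReal_one]
  have hμ : ∀ J, μ.real {J} = ∏ i, (P (J i)).toReal := by
    intro J
    simp [μ, Measure.real, ENNReal.toReal_prod]
  have hE := sum_prod_mul_codim_span_le a (fun j => (P j).toReal)
    (fun _ => ENNReal.toReal_nonneg) hp1 W haW hs1 hs d
  have hc : μ.real Sᶜ ≤ finrank 𝕜 W * (1 - s) ^ d := by
    refine le_trans ?_ hE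
    have : μ.real Sᶜ = ∑ J with J ∈ Sᶜ, μ.real {J} := by
      rw [sum_measureReal_singleton, Finset.coe_filter_univ]
      rfl
    rw [this, Finset.sum_filter]
    refine Finset.sum_le_sum fun J _ => ?_
    have hle : finrank 𝕜 (span 𝕜 (Set.range fun i => a (J i))) ≤ finrank 𝕜 W :=
      finrank_mono (span_le.2 (Set.range_subset_iff.2 fun i => haW _))
    have hpr : 0 ≤ ∏ i, (P (J i)).toReal := Finset.prod_nonneg fun _ _ => ENNReal.toReal_nonneg
    split_ifs with h
    -- The missing dimension is an integer, so on the failure event it is at least 1 and dominates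
    -- the indicator.
    · have hlt : finrank 𝕜 (span 𝕜 (Set.range fun i => a (J i))) + 1 ≤ finrank 𝕜 W :=
        lt_of_le_of_ne hle h
      have : (finrank 𝕜 (span 𝕜 (Set.range fun i => a (J i))) : ℝ) + 1 ≤ finrank 𝕜 W := by
        exact_mod_cast hlt
      rw [hμ]
      exact le_mul_of_one_le_right hpr (by linarith)
    · exact mul_nonneg hpr (sub_nonneg.2 (by exact_mod_cast hle))
  rw [ENNReal.ofReal_le_iff_le_toReal (measure_ne_top _ _)]
  have := probReal_compl_eq_one_sub (μ := μ) (s := S) (Set.toFinite S).measurableSet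
  change _ ≤ μ.real S
  linarith

/-! ### Singular value bounds for a map and its adjoint. -/

open Module in
theorem LinearMap.norm_sq_apply_eq_sum_eigenvalues {𝕜 E F : Type*} [RCLike 𝕜]
    [NormedAddCommGroup E] [InnerProductSpace 𝕜 E] [FiniteDimensional 𝕜 E]
    [NormedAddCommGroup F] [InnerProductSpace 𝕜 F] [FiniteDimensional 𝕜 F] (T : E →ₗ[𝕜] F)
    (x : E) :
    ‖T x‖ ^ 2 = ∑ i : Fin (finrank 𝕜 E), T.singularValues i ^ 2 *
      ‖(T.isSymmetric_adjoint_comp_self.eigenvectorBasis rfl).repr x i‖ ^ 2 := by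
  set b := T.isSymmetric_adjoint_comp_self.eigenvectorBasis rfl
  have h1 : ((‖T x‖ ^ 2 : ℝ) : 𝕜) = inner 𝕜 (b.repr x) (b.repr ((T.adjoint ∘ₗ T) x)) := by
    rw [b.repr.inner_map_map, LinearMap.comp_apply, LinearMap.adjoint_inner_right,
      inner_self_eq_norm_sq_to_K]
    simp
  have h2 : ((‖T x‖ ^ 2 : ℝ) : 𝕜) = ((∑ i : Fin (finrank 𝕜 E), T.singularValues i ^ 2 *
      ‖b.repr x i‖ ^ 2 : ℝ) : 𝕜) := by
    rw [h1, PiLp.inner_apply, RCLike.ofReal_sum]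
    refine Finset.sum_congr rfl fun i _ => ?_
    rw [LinearMap.IsSymmetric.eigenvectorBasis_apply_self_apply, T.sq_singularValues_fin rfl,
      RCLike.inner_apply, mul_assoc, RCLike.mul_conj]
    push_cast
    rfl
  exact_mod_cast h2

open Module in
theorem LinearMap.norm_sq_apply_le_singularValues_zero {𝕜 E F : Type*} [RCLike 𝕜]
    [NormedAddCommGroup E] [InnerProductSpace 𝕜 E] [FiniteDimensional 𝕜 E]
    [NormedAddCommGroup F] [InnerProductSpace 𝕜 F] [FiniteDimensional 𝕜 F] (T : E →ₗ[𝕜] F)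
    (x : E) : ‖T x‖ ^ 2 ≤ T.singularValues 0 ^ 2 * ‖x‖ ^ 2 := by
  rw [T.norm_sq_apply_eq_sum_eigenvalues,
    ← (T.isSymmetric_adjoint_comp_self.eigenvectorBasis rfl).repr.norm_map x,
    EuclideanSpace.norm_sq_eq, Finset.mul_sum]
  refine Finset.sum_le_sum fun i _ => ?_
  gcongr
  · exact T.singularValues_nonneg _
  · exact T.singularValues_antitone (Nat.zero_le _)

-- In the eigenbasis of `T* T`, a vector of `range T*` has no coordinate along a zero singular
-- value, and every other singular value has index at most `rank - 1`.
open Module in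
theorem LinearMap.singularValues_mul_norm_le_of_mem_range_adjoint {𝕜 E F : Type*} [RCLike 𝕜]
    [NormedAddCommGroup E] [InnerProductSpace 𝕜 E] [FiniteDimensional 𝕜 E]
    [NormedAddCommGroup F] [InnerProductSpace 𝕜 F] [FiniteDimensional 𝕜 F] (T : E →ₗ[𝕜] F)
    {x : E} (hx : x ∈ T.adjoint.range) :
    T.singularValues (finrank 𝕜 T.range - 1) * ‖x‖ ≤ ‖T x‖ := by
  refine le_of_sq_le_sq ?_ (norm_nonneg _)
  rw [mul_pow, T.norm_sq_apply_eq_sum_eigenvalues,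
    ← (T.isSymmetric_adjoint_comp_self.eigenvectorBasis rfl).repr.norm_map x,
    EuclideanSpace.norm_sq_eq, Finset.mul_sum]
  refine Finset.sum_le_sum fun i _ => ?_
  by_cases hi : (i : ℕ) < finrank 𝕜 T.range
  · gcongr
    · exact T.singularValues_nonneg _
    · exact T.singularValues_antitone (by omega)
  · have h0 : T.singularValues i = 0 :=
      T.singularValues_eq_zero_iff_le_finrank_range.2 (not_lt.1 hi)
    have hr : (T.isSymmetric_adjoint_comp_self.eigenvectorBasis rfl).repr x i = 0 := by
      rw [← T.range_adjoint_comp_self] at hx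
      obtain ⟨y, rfl⟩ := hx
      rw [LinearMap.IsSymmetric.eigenvectorBasis_apply_self_apply, ← T.sq_singularValues_fin rfl,
        h0]
      simp
    rw [hr]
    simp

-- This avoids comparing the singular values of `T` and `T*`. With `u = T x` and `x ∈ range T*`,
-- Cauchy–Schwarz gives `‖T x‖² ≤ ‖x‖ ‖T* T x‖`; inserting `σ ‖x‖ ≤ ‖T x‖` and cancelling `‖T x‖`
-- leaves the bound.
open Module in
theorem LinearMap.singularValues_mul_norm_le_norm_adjoint {𝕜 E F : Type*} [RCLike 𝕜]
    [NormedAddCommGroup E] [InnerProductSpace 𝕜 E] [FiniteDimensional 𝕜 E]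
    [NormedAddCommGroup F] [InnerProductSpace 𝕜 F] [FiniteDimensional 𝕜 F] (T : E →ₗ[𝕜] F)
    {u : F} (hu : u ∈ T.range) :
    T.singularValues (finrank 𝕜 T.range - 1) * ‖u‖ ≤ ‖T.adjoint u‖ := by
  rw [← T.range_self_comp_adjoint] at hu
  obtain ⟨y, rfl⟩ := hu
  rw [LinearMap.comp_apply]
  set x := T.adjoint y
  have hx := T.singularValues_mul_norm_le_of_mem_range_adjoint (LinearMap.mem_range_self _ y)
  have h : ‖T x‖ ^ 2 ≤ ‖x‖ * ‖T.adjoint (T x)‖ := by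
    refine le_trans (le_of_eq ?_) (norm_inner_le_norm (𝕜 := 𝕜) x (T.adjoint (T x)))
    rw [LinearMap.adjoint_inner_right, inner_self_eq_norm_sq_to_K]
    simp
  have hs := T.singularValues_nonneg (finrank 𝕜 T.range - 1)
  rcases (norm_nonneg (T x)).eq_or_lt with h0 | h0
  · rw [← h0, mul_zero]
    exact norm_nonneg _
  · refine le_of_mul_le_mul_left ?_ h0
    change _ * ‖x‖ ≤ _ at hx
    nlinarith [norm_nonneg (T.adjoint (T x)), mul_le_mul_of_nonneg_left h hs,
      mul_le_mul_of_nonneg_right hx (norm_nonneg (T.adjoint (T x)))]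

/-! ### Exactness of CUR at full rank. -/

/-- Nested column spaces of equal dimension coincide, so each column of `A` is a combination of the
selected ones; `X` collects the coefficients. -/
theorem Matrix.exists_eq_submatrix_mul_of_rank_eq {K m n o : Type*} [Field K] [Fintype m]
    [Fintype n] [Fintype o] (A : Matrix m n K) (J : o → n)
    (h : (A.submatrix id J).rank = A.rank) : ∃ X : Matrix o n K, A = A.submatrix id J * X := by
  classical
  have hle : (A.submatrix id J).mulVecLin.range ≤ A.mulVecLin.range := by
    rw [Matrix.range_mulVecLin, Matrix.range_mulVecLin]
    refine Submodule.span_mono ?_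
    rintro _ ⟨j, rfl⟩
    exact ⟨J j, rfl⟩
  have heq := Submodule.eq_of_le_of_finrank_eq hle h
  have hcol : ∀ j, ∃ x, A.submatrix id J *ᵥ x = A.col j := by
    intro j
    have : A.col j ∈ (A.submatrix id J).mulVecLin.range := by
      rw [heq, Matrix.range_mulVecLin]
      exact Submodule.subset_span ⟨j, rfl⟩
    exact this
  choose x hx using hcol
  refine ⟨(Matrix.of x)ᵀ, ?_⟩
  ext i j
  exact (congrFun (hx j) i).symm

/-- A CUR decomposition is exact once the chosen columns and the chosen rows have full rank. -/
theorem eq_colSubmatrix_mul_moorePenroseInverse_mul_rowSubmatrix {𝕜 : Type*} [RCLike 𝕜]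
    {m n d₁ d₂ : ℕ} (A : Matrix (Fin m) (Fin n) 𝕜) (J : Fin d₁ → Fin n) (I : Fin d₂ → Fin m)
    (hJ : (colSubmatrix A J).rank = A.rank) (hI : (rowSubmatrix A I).rank = A.rank) :
    A = colSubmatrix A J * moorePenroseInverse (A.submatrix I J) * rowSubmatrix A I := by
  obtain ⟨X, hX⟩ := A.exists_eq_submatrix_mul_of_rank_eq J hJ
  obtain ⟨Z, hZ⟩ := Aᵀ.exists_eq_submatrix_mul_of_rank_eq I (by
    rw [Matrix.rank_transpose, ← hI, ← Matrix.rank_transpose (rowSubmatrix A I)]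
    rfl)
  have hY : A = Zᵀ * rowSubmatrix A I := by
    have := congrArg Matrix.transpose hZ
    rwa [Matrix.transpose_mul, Matrix.transpose_transpose] at this
  set U := A.submatrix I J with hU
  -- Restrict `A = Zᵀ R` to the columns `J`; below, `A = C X` is restricted to the rows `I`.
  have hC : colSubmatrix A J = Zᵀ * U := by
    ext i j
    exact congrFun (congrFun hY i) (J j)
  have hR : rowSubmatrix A I = U * X := by
    ext i j
    exact congrFun (congrFun hX (I i)) j
  have hU := (moorePenroseInverse_spec U).mul_mul_self
  calc A = Zᵀ * (U * moorePenroseInverse U * U) * X := by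
        rw [hU, ← hC]
        exact hX
    _ = _ := by rw [hC, hR]; simp only [Matrix.mul_assoc]

/-! ### Length-squared sampling of matrix columns. -/

open scoped ComplexOrder in
theorem Matrix.rank_conjTranspose_of_rclike {𝕜 : Type*} [RCLike 𝕜] {m n : ℕ}
    (A : Matrix (Fin m) (Fin n) 𝕜) : Aᴴ.rank = A.rank :=
  A.rank_conjTranspose

theorem finrank_range_euclideanMap {𝕜 : Type*} [RCLike 𝕜] {m n : ℕ}
    (A : Matrix (Fin m) (Fin n) 𝕜) : Module.finrank 𝕜 (euclideanMap A).range = A.rank := by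
  rw [A.rank_eq_finrank_range_toLin (EuclideanSpace.basisFun (Fin m) 𝕜).toBasis
    (EuclideanSpace.basisFun (Fin n) 𝕜).toBasis, ← Matrix.toEuclideanLin_eq_toLin_orthonormal]

theorem range_euclideanMap {𝕜 : Type*} [RCLike 𝕜] {m n : ℕ} (A : Matrix (Fin m) (Fin n) 𝕜) :
    (euclideanMap A).range =
      Submodule.span 𝕜 (Set.range fun j => euclideanMap A (EuclideanSpace.basisFun (Fin n) 𝕜 j)) := by
  rw [← Submodule.map_top, ← (EuclideanSpace.basisFun (Fin n) 𝕜).toBasis.span_eq,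
    Submodule.map_span, ← Set.range_comp]
  simp [Function.comp_def]

theorem euclideanMap_basisFun_apply {𝕜 : Type*} [RCLike 𝕜] {m n : ℕ}
    (A : Matrix (Fin m) (Fin n) 𝕜) (j : Fin n) (i : Fin m) :
    euclideanMap A (EuclideanSpace.basisFun (Fin n) 𝕜 j) i = A i j := by
  simp [Matrix.toLpLin_apply]

/-- Columns drawn with probability proportional to their squared length have full rank except with
probability at most `rank M * (1 - σ ^ 2 / F) ^ d`, where `σ` bounds from below the adjoint on the
column space. -/
theorem one_sub_le_pi_rank_submatrix_eq {𝕜 : Type*} [RCLike 𝕜] {m n : ℕ}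
    (M : Matrix (Fin m) (Fin n) 𝕜) (hM : 1 ≤ M.rank) (P : PMF (Fin n)) {F σ : ℝ} (hF : 0 < F)
    (hσ : 0 ≤ σ) (hP : ∀ j, (P j).toReal = (∑ i, ‖M i j‖ ^ 2) / F)
    (hs : ∀ u ∈ (euclideanMap M).range, σ * ‖u‖ ≤ ‖(euclideanMap M).adjoint u‖) (d : ℕ) :
    σ ^ 2 / F ≤ 1 ∧ ENNReal.ofReal (1 - M.rank * (1 - σ ^ 2 / F) ^ d) ≤
      MeasureTheory.Measure.pi (fun _ : Fin d => P.toMeasure)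
        {J | (M.submatrix id J).rank = M.rank} := by
  classical
  set e := EuclideanSpace.basisFun (Fin n) 𝕜
  set a : Fin n → EuclideanSpace 𝕜 (Fin m) := fun j => euclideanMap M (e j) with ha
  have hP' : ∀ j, (P j).toReal = ‖a j‖ ^ 2 / F := by
    intro j
    rw [hP, EuclideanSpace.norm_sq_eq]
    simp only [ha, e, euclideanMap_basisFun_apply]
  have hframe : ∀ u ∈ (euclideanMap M).range,
      σ ^ 2 * ‖u‖ ^ 2 ≤ ∑ j, ‖inner 𝕜 u (a j)‖ ^ 2 := by
    intro u hu
    -- The inner products with the columns `M e_j` are, up to conjugation, the coordinates of `M*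
    -- u`.
    have h : ∑ j, ‖inner 𝕜 u (a j)‖ ^ 2 = ‖(euclideanMap M).adjoint u‖ ^ 2 := by
      rw [← e.sum_sq_norm_inner_left]
      simp only [ha, LinearMap.adjoint_inner_left]
    rw [h, ← mul_pow]
    exact pow_le_pow_left₀ (by positivity) (hs u hu) 2
  have hdrop : ∀ V ≤ (euclideanMap M).range, ∀ [DecidablePred fun j => a j ∉ V],
      ((Module.finrank 𝕜 (euclideanMap M).range : ℝ) - Module.finrank 𝕜 V) * (σ ^ 2 / F) ≤
        ∑ j with a j ∉ V, (P j).toReal := by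
    intro V hV _
    simp_rw [hP']
    rw [← Finset.sum_div, ← mul_div_assoc]
    exact div_le_div_of_nonneg_right (mul_codim_le_sum_norm_sq_of_notMem a _ V hV hframe) hF.le
  have hp1 : ∑ j, (P j).toReal = 1 := by
    rw [← ENNReal.toReal_sum fun j _ => P.apply_ne_top j, ← tsum_fintype (L := .unconditional _),
      P.tsum_coe, ENNReal.toReal_one]
  -- With `V = ⊥` the drop estimate reads `rank M * s ≤ 1`, and the rank is at least 1.
  have hs1 : σ ^ 2 / F ≤ 1 := by
    have h := (hdrop ⊥ bot_le).trans
      ((Finset.sum_le_univ_sum_of_nonneg fun _ => ENNReal.toReal_nonneg).trans hp1.le)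
    rw [finrank_range_euclideanMap, finrank_bot, Nat.cast_zero, sub_zero] at h
    refine le_trans (le_mul_of_one_le_left (by positivity) ?_) h
    exact_mod_cast hM
  refine ⟨hs1, ?_⟩
  have := one_sub_le_pi_finrank_span_eq a P (euclideanMap M).range
    (fun j => LinearMap.mem_range_self _ _) hs1 hdrop d
  rw [finrank_range_euclideanMap] at this
  refine this.trans (MeasureTheory.measure_mono fun J hJ => ?_)
  rw [Set.mem_ofPred_eq] at hJ ⊢
  have hsub : (fun i => euclideanMap (M.submatrix id J) (EuclideanSpace.basisFun (Fin d) 𝕜 i)) =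
      fun i => a (J i) := by
    funext i
    ext l
    rw [euclideanMap_basisFun_apply, ha, euclideanMap_basisFun_apply]
    rfl
  rw [← finrank_range_euclideanMap, range_euclideanMap, hsub, hJ]

/-! ### Stable rank, condition number and the sample size. -/

theorem spectralNorm₂_le_singularValues_zero {𝕜 : Type*} [RCLike 𝕜] {m n : ℕ}
    (A : Matrix (Fin m) (Fin n) 𝕜) : spectralNorm₂ A ≤ (euclideanMap A).singularValues 0 := by
  refine ContinuousLinearMap.opNorm_le_bound _ (LinearMap.singularValues_nonneg _ _) fun x => ?_
  refine le_of_sq_le_sq ?_ (mul_nonneg (LinearMap.singularValues_nonneg _ _) (norm_nonneg _))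
  rw [mul_pow]
  exact (euclideanMap A).norm_sq_apply_le_singularValues_zero x

theorem spectralNorm₂_pos {𝕜 : Type*} [RCLike 𝕜] {m n : ℕ} {A : Matrix (Fin m) (Fin n) 𝕜}
    (hA : A ≠ 0) : 0 < spectralNorm₂ A := by
  refine norm_pos_iff.2 fun h => hA ?_
  have : euclideanMap A = 0 := by simpa using h
  exact Matrix.toEuclideanLin.map_eq_zero_iff.1 this

/-- The product on the right is `‖A‖_F² / σ_k²` times `σ_1² / ‖A‖₂²`, so `‖A‖₂ ≤ σ_1` suffices. -/
theorem frobeniusSq_div_le_stableRank_mul_condNumber_sq {𝕜 : Type*} [RCLike 𝕜] {m n : ℕ}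
    {A : Matrix (Fin m) (Fin n) 𝕜} (hA : A ≠ 0) :
    frobeniusSq A / (euclideanMap A).singularValues (A.rank - 1) ^ 2 ≤
      stableRank A * condNumber A ^ 2 := by
  have h0 := spectralNorm₂_pos hA
  have h1 := spectralNorm₂_le_singularValues_zero A
  have hF := frobeniusSq_pos hA
  have hq : 1 ≤ (euclideanMap A).singularValues 0 ^ 2 / spectralNorm₂ A ^ 2 := by
    rw [one_le_div (by positivity)]
    gcongr
  calc _ ≤ frobeniusSq A / (euclideanMap A).singularValues (A.rank - 1) ^ 2 *
        ((euclideanMap A).singularValues 0 ^ 2 / spectralNorm₂ A ^ 2) :=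
        le_mul_of_one_le_right (by positivity) hq
    _ = _ := by rw [stableRank, condNumber]; ring

/-- From `1 - s ≤ exp (-s)` and `d s ≥ log (2k) + t` the left side is already at most `exp (-t) /
2`; the constants 8 and 2 leave slack. -/
theorem natCast_mul_one_sub_pow_le_exp {k d : ℕ} (hk : 1 ≤ k) {ρ s t : ℝ} (hs0 : 0 < s)
    (hs1 : s ≤ 1) (hρ : 1 / s ≤ ρ) (ht : 0 ≤ t) (hd : 8 * ρ * (Real.log (2 * (k : ℝ)) + t) ≤ d) :
    k * (1 - s) ^ d ≤ 2 * Real.exp (-t) := by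
  have hk' : (1 : ℝ) ≤ k := by exact_mod_cast hk
  have hlog : 0 ≤ Real.log (2 * (k : ℝ)) := Real.log_nonneg (by linarith)
  set c := Real.log (2 * (k : ℝ)) + t with hc
  have hds : c ≤ d * s := by
    have h1 : 1 ≤ ρ * s := (div_le_iff₀ hs0).1 hρ
    have h2 := mul_le_mul_of_nonneg_right hd hs0.le
    nlinarith [mul_le_mul_of_nonneg_right h1 (by positivity : 0 ≤ c)]
  calc k * (1 - s) ^ d ≤ k * Real.exp (-s) ^ d := by
        gcongr
        exact Real.one_sub_le_exp_neg s
    _ = k * Real.exp (-(d * s)) := by rw [← Real.exp_nat_mul]; ring_nf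
    _ ≤ k * Real.exp (-Real.log (2 * (k : ℝ)) + -t) := by
        gcongr
        linarith
    _ = 1 / 2 * Real.exp (-t) := by
        rw [Real.exp_add, Real.exp_neg, Real.exp_log (by linarith)]
        field_simp
    _ ≤ 2 * Real.exp (-t) := by
        gcongr
        norm_num

theorem mainTheorem6 {𝕜 : Type*} [RCLike 𝕜] {m n : ℕ} (A : Matrix (Fin m) (Fin n) 𝕜)
    (hA : A ≠ 0) (k : ℕ) (hk : A.rank = k) (r : ℝ) (hr : stableRank A = r)
    (δ : ℝ) (hδ : δ ∈ Set.Ioo (0 : ℝ) 1) (d₁ d₂ : ℕ)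
    (hd₁ : 8 * r * condNumber A ^ 2 * (Real.log (2 * (k : ℝ)) + 1 / δ) ≤ (d₁ : ℝ))
    (hd₂ : 8 * r * condNumber A ^ 2 * (Real.log (2 * (k : ℝ)) + 1 / δ) ≤ (d₂ : ℝ)) :
    ENNReal.ofReal ((1 - 2 * Real.exp (-(1 / δ))) ^ 2) ≤
      lengthSampling A hA d₁ d₂
        {ω | A = colSubmatrix A ω.1 * moorePenroseInverse (A.submatrix ω.2 ω.1) *
          rowSubmatrix A ω.2} := by
  subst hr hk
  have hF := frobeniusSq_pos hA
  have hrank : 1 ≤ A.rank := by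
    rw [Nat.one_le_iff_ne_zero, ← finrank_range_euclideanMap, Ne, Submodule.finrank_eq_zero,
      LinearMap.range_eq_bot]
    exact fun h => hA (Matrix.toEuclideanLin.map_eq_zero_iff.1 h)
  have hρ := frobeniusSq_div_le_stableRank_mul_condNumber_sq hA
  set σ := (euclideanMap A).singularValues (A.rank - 1) with hσ
  have hσ0 : 0 < σ := by
    rw [hσ, LinearMap.singularValues_pos_iff_lt_finrank_range, finrank_range_euclideanMap]
    omega
  rw [← one_div_div] at hρ
  have hs0 : 0 < σ ^ 2 / frobeniusSq A := by positivity
  have hδ0 : 0 ≤ 1 / δ := one_div_nonneg.2 hδ.1.le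
  rw [mul_assoc 8] at hd₁ hd₂
  obtain ⟨hs1, hcol⟩ := one_sub_le_pi_rank_submatrix_eq A hrank (colLengthPMF A hA) hF hσ0.le
    (fun j => by
      rw [colLengthPMF, PMF.ofFintype_apply, ENNReal.toReal_ofReal (by positivity)])
    (fun u hu => by
      have := (euclideanMap A).singularValues_mul_norm_le_norm_adjoint hu
      rwa [finrank_range_euclideanMap] at this) d₁
  have hadj : euclideanMap Aᴴ = (euclideanMap A).adjoint :=
    Matrix.toEuclideanLin_conjTranspose_eq_adjoint A
  -- The rows are sampled as columns of `Aᴴ`, whose adjoint is `A` itself. The frame bound is then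
  -- the lower bound for `A` on `range A*`, with the same `σ`.
  obtain ⟨-, hrow⟩ := one_sub_le_pi_rank_submatrix_eq Aᴴ (by rwa [Matrix.rank_conjTranspose_of_rclike])
    (rowLengthPMF A hA) hF hσ0.le
    (fun i => by
      rw [rowLengthPMF, PMF.ofFintype_apply, ENNReal.toReal_ofReal (by positivity)]
      simp)
    (fun u hu => by
      rw [hadj] at hu ⊢
      rw [LinearMap.adjoint_adjoint]
      have := (euclideanMap A).singularValues_mul_norm_le_of_mem_range_adjoint hu
      rwa [finrank_range_euclideanMap] at this) d₂
  -- Nonnegativity lets `ENNReal.ofReal` split over the square; `δ < 1` gives `exp (1/δ) ≥ 2`.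
  have hδ1 : 0 ≤ 1 - 2 * Real.exp (-(1 / δ)) := by
    have h1 : 1 ≤ 1 / δ := by
      rw [one_le_div hδ.1]
      exact hδ.2.le
    have h2 : 2 ≤ Real.exp (1 / δ) := by linarith [Real.add_one_le_exp (1 / δ)]
    rw [Real.exp_neg, sub_nonneg, ← div_eq_mul_inv, div_le_one (Real.exp_pos _)]
    exact h2
  rw [pow_two, ENNReal.ofReal_mul hδ1]
  calc _ ≤ _ := mul_le_mul' (le_trans (ENNReal.ofReal_le_ofReal (sub_le_sub_left
          (natCast_mul_one_sub_pow_le_exp hrank hs0 hs1 hρ hδ0 hd₁) 1)) hcol)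
        (le_trans (ENNReal.ofReal_le_ofReal (sub_le_sub_left (by
          rw [Matrix.rank_conjTranspose_of_rclike]
          exact natCast_mul_one_sub_pow_le_exp hrank hs0 hs1 hρ hδ0 hd₂) 1)) hrow)
    -- Independence: the two full-rank events form a rectangle for the product measure.
    _ = _ := (MeasureTheory.Measure.prod_prod _ _).symm
    _ ≤ _ := MeasureTheory.measure_mono fun ω hω => by
        refine eq_colSubmatrix_mul_moorePenroseInverse_mul_rowSubmatrix A ω.1 ω.2 hω.1 ?_
        have h := hω.2
        rwa [Set.mem_ofPred_eq, Matrix.rank_conjTranspose_of_rclike,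
          show Aᴴ.submatrix id ω.2 = (rowSubmatrix A ω.2)ᴴ from rfl,
          Matrix.rank_conjTranspose_of_rclike] at h
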